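/- **Setting.** Let $z^\infty=(z_1,z_2,\dots)\in\{0,1\}^\infty$ be a fixed noise sequence. The channel is $y_i=x_i+z_i \pmod 2$ with noiseless feedback delayed by one time unit. The source $M^\infty$ is iid Bernoulli$(1/2)$. A finite-state (FS) feedback scheme consists of: encoder and decoder states $s^{(e)}_i,s^{(d)}_i$ in a finite set $S$ (with given initial values); a lookahead constant $\ell\ge 0$; a common randomness sequence $\theta_1,\theta_2,\dots$, iid with some law $p_\theta$ on a finite alphabet and independent of $M^\infty$; a source pointer $p_i$ with $p_1=1$ and $p_{i+1}=p_i+L_i$; an encoding function $x_i=e(s^{(e)}_i,M_{p_i}^{p_i+\ell},y_{i-1},\theta_i)$ (with a given initial symbol $y_0$); a decoding length $L_i=d_L(s^{(d)}_i,y_i,\theta_i)\in\{0,1,2,\dots\}$; a decoding function $\widehat M_{p_i}^{p_i+L_i-1}=d_M(s^{(d)}_i,y_i,\theta_i)$; and state updates $s^{(e)}_{i+1}=f_{(e)}(s^{(e)}_i,M_{p_i}^{p_i+\ell},y_i,\theta_i)$, $s^{(d)}_{i+1}=f_{(d)}(s^{(d)}_i,y_i,\theta_i)$. Put $$R_n=\frac1n\sum_{i=1}^nL_i,\qquad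 \epsilon_n=\frac1{nR_n}\sum_{i=1}^{nR_n}\mathbf 1_{\widehat M_i\ne M_i}.$$ The scheme worst-case $p$-achieves $(R,\epsilon)$ for $z^\infty$ if, with probability at least $p$ over $(M^\infty,\theta^\infty)$, both $\liminf_n R_n\ge R$ and $\limsup_n\epsilon_n\le\epsilon$. Let $h_b$ be the binary entropy function (base 2), and let $$\overline\rho(z^\infty)=\limsup_{k\to\infty}\limsup_{n\to\infty}\frac1k\widehat H^k_{\rm sw}(z^n),\qquad \underline\sigma(z^\infty)=1-\overline\rho(z^\infty),$$ where $\widehat H^k_{\rm sw}(z^n)$ is the entropy (base 2) of the empirical distribution of the $n-k+1$ length-$k$ windows of $z_1,\dots,z_n$. **Theorem.** Suppose that an FS scheme worst-case $p$-achieves $(R,\epsilon)$ for $z^\infty$ with $p>0$ and $\epsilon\le 1/2$. If $R\le 1$ (the maximal rate of the binary channel), then $$R\le h_b(\epsilon)+\underline\sigma(z^\infty).$$ Moreover, for every real $R$, $R\,(1-h_b(\epsilon))\le\underline\sigma(z^\infty)$; in particular, $R\le\underline\sigma(z^\infty)$ if $\epsilon=0$. -/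

import Mathlib

open MeasureTheory Filter

namespace Porosity

/-! ### Empirical entropy, compressibility, porosity

Sequences are indexed from `0`; all entropies are in bits. -/

/-- Sliding-window empirical distribution of order `k` of the first `n` letters of `x`: the
fraction of the `n - k + 1` windows `x i, …, x (i + k - 1)` that are equal to `w`. -/
noncomputable def slidingFreq {A : Type*} [DecidableEq A] (x : ℕ → A) (k n : ℕ)
    (w : Fin k → A) : ℝ :=
  (((Finset.range (n + 1 - k)).filter fun i => ∀ j : Fin k, x (i + j) = w j).card : ℝ)
    / ((n + 1 - k : ℕ) : ℝ)

/-- Sliding-window empirical entropy of order `k` of the first `n` letters of `x`, in bits. -/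
noncomputable def slidingEntropy {A : Type*} [Fintype A] [DecidableEq A] (x : ℕ → A)
    (k n : ℕ) : ℝ :=
  (∑ w : Fin k → A, Real.negMulLog (slidingFreq x k n w)) / Real.log 2

/-- The (worst-case) finite-state compressibility
`limsup_k limsup_n (1/k) H_sw^k(x^n)`. -/
noncomputable def worstCompressibility {A : Type*} [Fintype A] [DecidableEq A]
    (x : ℕ → A) : ℝ :=
  limsup (fun k : ℕ => limsup (fun n : ℕ => slidingEntropy x k n / (k : ℝ)) atTop) atTop

/-- The worst-case porosity `log₂ |A| - ρ̄(x)`. -/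
noncomputable def worstPorosity {A : Type*} [Fintype A] [DecidableEq A] (x : ℕ → A) : ℝ :=
  Real.logb 2 (Fintype.card A) - worstCompressibility x

/-- The binary entropy function, in bits (Mathlib's `Real.binEntropy` is in nats). -/
noncomputable def hb (ε : ℝ) : ℝ := Real.binEntropy ε / Real.log 2

/-! ### Finite-state feedback schemes over the binary additive channel -/

/-- A finite-state encoder/decoder scheme with (finite) state set `S` and (finite) common
randomness alphabet `Θ`, for the binary additive-noise channel with delay-one noiseless feedback.
Addition modulo two is `xor` on `Bool`. -/
structure FSScheme (S Θ : Type*) where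
  /-- the lookahead constant `ℓ` -/
  lookahead : ℕ
  /-- the law of one letter of the common randomness -/
  pθ : PMF Θ
  /-- the initial encoder state -/
  encInit : S
  /-- the initial decoder state -/
  decInit : S
  /-- the feedback symbol seen by the encoder before the first channel use -/
  fbInit : Bool
  /-- encoding function: state, source window `M_p, …, M_{p+ℓ}`, feedback (the previous channel
  output), common randomness -/
  enc : S → (Fin (lookahead + 1) → Bool) → Bool → Θ → Bool
  /-- decoding length: state, channel output, common randomness -/
  decLen : S → Bool → Θ → ℕ
  /-- decoding function: the estimate of the next `decLen` source bits -/
  decMsg : (s : S) → (y : Bool) → (t : Θ) → Fin (decLen s y t) → Bool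
  /-- encoder state update: state, source window, channel output, common randomness -/
  encUpdate : S → (Fin (lookahead + 1) → Bool) → Bool → Θ → S
  /-- decoder state update: state, channel output, common randomness -/
  decUpdate : S → Bool → Θ → S

/-- The situation just before a channel use: encoder state, decoder state, feedback symbol (the
previous channel output) and source pointer. -/
structure Config (S : Type*) where
  encState : S
  decState : S
  fb : Bool
  ptr : ℕ

namespace FSScheme

variable {S Θ : Type*}

/-- The source window `M_p, …, M_{p+ℓ}` at the pointer `p`. -/
def window (F : FSScheme S Θ) (M : ℕ → Bool) (p : ℕ) : Fin (F.lookahead + 1) → Bool :=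
  fun j => M (p + j)

/-- The channel output `y = x + z` in configuration `c`. -/
def outputAt (F : FSScheme S Θ) (M : ℕ → Bool) (c : Config S) (z : Bool) (t : Θ) : Bool :=
  xor (F.enc c.encState (F.window M c.ptr) c.fb t) z

/-- One channel use. -/
def step (F : FSScheme S Θ) (M : ℕ → Bool) (c : Config S) (z : Bool) (t : Θ) : Config S where
  encState := F.encUpdate c.encState (F.window M c.ptr) (F.outputAt M c z t) t
  decState := F.decUpdate c.decState (F.outputAt M c z t) t
  fb := F.outputAt M c z t
  ptr := c.ptr + F.decLen c.decState (F.outputAt M c z t) t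

/-- The configuration before channel use `i` (the channel uses are numbered `0, 1, 2, …`), for the
source `M`, the noise `z` and the common randomness `θ`. -/
def config (F : FSScheme S Θ) (M z : ℕ → Bool) (θ : ℕ → Θ) : ℕ → Config S
  | 0 => ⟨F.encInit, F.decInit, F.fbInit, 0⟩
  | i + 1 => F.step M (F.config M z θ i) (z i) (θ i)

/-- The channel output at channel use `i`. -/
def output (F : FSScheme S Θ) (M z : ℕ → Bool) (θ : ℕ → Θ) (i : ℕ) : Bool :=
  F.outputAt M (F.config M z θ i) (z i) (θ i)

/-- The number `L_i` of source bits estimated at channel use `i`. -/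
def len (F : FSScheme S Θ) (M z : ℕ → Bool) (θ : ℕ → Θ) (i : ℕ) : ℕ :=
  F.decLen (F.config M z θ i).decState (F.output M z θ i) (θ i)

/-- The number of wrong bits among the estimates of `M_{p_i}, …, M_{p_i + L_i - 1}` made at
channel use `i`. -/
def errors (F : FSScheme S Θ) (M z : ℕ → Bool) (θ : ℕ → Θ) (i : ℕ) : ℕ :=
  (Finset.univ.filter fun j : Fin (F.decLen (F.config M z θ i).decState
      (F.output M z θ i) (θ i)) =>
    F.decMsg (F.config M z θ i).decState (F.output M z θ i) (θ i) j
      ≠ M ((F.config M z θ i).ptr + j)).card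

/-- The rate `R_n` after `n` channel uses. -/
noncomputable def rate (F : FSScheme S Θ) (M z : ℕ → Bool) (θ : ℕ → Θ) (n : ℕ) : ℝ :=
  (∑ i ∈ Finset.range n, (F.len M z θ i : ℝ)) / (n : ℝ)

/-- The bit-error rate `ε_n` after `n` channel uses: the fraction of wrong bits among the
`n R_n = L_0 + ⋯ + L_{n-1}` source bits estimated so far (these are the first `n R_n` source bits,
each of them estimated exactly once). -/
noncomputable def bitErrorRate (F : FSScheme S Θ) (M z : ℕ → Bool) (θ : ℕ → Θ) (n : ℕ) : ℝ :=
  (∑ i ∈ Finset.range n, (F.errors M z θ i : ℝ)) / (∑ i ∈ Finset.range n, (F.len M z θ i : ℝ))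

/-- The joint law of the source and the common randomness: the source bits are iid
Bernoulli(1/2), the letters of the common randomness are iid with law `pθ`, and the two sequences
are independent. -/
noncomputable def law [MeasurableSpace Θ] (F : FSScheme S Θ) :
    Measure ((ℕ → Bool) × (ℕ → Θ)) :=
  (Measure.infinitePi fun _ : ℕ => (PMF.uniformOfFintype Bool).toMeasure).prod
    (Measure.infinitePi fun _ : ℕ => F.pθ.toMeasure)

/-- The scheme worst-case `p`-achieves `(R, ε)` for the noise sequence `z`: with probability at
least `p`, both `liminf R_n ≥ R` and `limsup ε_n ≤ ε`. -/
def WorstCaseAchieves [MeasurableSpace Θ] (F : FSScheme S Θ) (z : ℕ → Bool) (p R ε : ℝ) : Prop :=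
  p ≤ F.law.real {ω | R ≤ liminf (fun n => F.rate ω.1 z ω.2 n) atTop ∧
    limsup (fun n => F.bitErrorRate ω.1 z ω.2 n) atTop ≤ ε}

end FSScheme

end Porosity

/-! The decoder's estimates are read as bets on the source. Fix `β` slightly above `ε`; a wrong bit
multiplies the capital by `2 * β`, a right one by `2 * (1 - β)`. Against a fair bit this factor has
mean 1.

For a fixed source and common randomness, noise words and output words are in bijection, and a fixed
output word fixes the bets. Hence the mean capital, summed over all noise words of length `k`, is
exactly `2 ^ k` (`sum_meanWeight`): divided by `2 ^ k`, it is a probability on noise words. Along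
the actual noise, with probability more than `p / 2` and for all large `n`, the capital is at least
`2 ^ (n * R' * (1 - hb β))` for any `0 ≤ R' < R`, so its mean grows at that rate
(`exists_le_meanWeight`).

To pass from `z^n` to its windows of length `k`, the mean capital must split over concatenations.
The past reaches the future only through the finite states, the feedback bit and the at most `ℓ + 1`
source bits already seen past the pointer. `potential` sums over the former and pays `2 ^ (ℓ + 1)`
for the latter; it is submultiplicative (`potential_append_le`) with total mass still `O(2 ^ k)`.
Gibbs' inequality on the empirical window distribution then bounds the compressibility by `1 - R' *
(1 - hb β)` (`worstCompressibility_le`).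

Letting `R'` tend to `R` and `β` to `ε` gives the product bound; the additive bound follows from `R
* hb ε ≤ hb ε` when `R ≤ 1`. -/

open scoped ENNReal

namespace Porosity

/-! ### Words and sliding windows -/

/-- The word `x i, …, x (i + k - 1)`. -/
def word {A : Type*} (x : ℕ → A) (i k : ℕ) : List A := List.ofFn fun j : Fin k => x (i + j)

lemma word_add {A : Type*} (x : ℕ → A) (i m n : ℕ) :
    word x i (m + n) = word x i m ++ word x (i + m) n := by
  simp [word, List.ofFn_add, add_assoc]

lemma word_one {A : Type*} (x : ℕ → A) (i : ℕ) : word x i 1 = [x i] := by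
  simp [word]

lemma length_word {A : Type*} (x : ℕ → A) (i k : ℕ) : (word x i k).length = k := by
  simp [word]

section Sliding

variable {A : Type*} [DecidableEq A]

lemma slidingFreq_nonneg (x : ℕ → A) (k n : ℕ) (w : Fin k → A) : 0 ≤ slidingFreq x k n w := by
  unfold slidingFreq; positivity

lemma slidingFreq_le_one (x : ℕ → A) (k n : ℕ) (w : Fin k → A) : slidingFreq x k n w ≤ 1 := by
  unfold slidingFreq
  refine div_le_one_of_le₀ ?_ (by positivity)
  exact_mod_cast (Finset.card_filter_le _ _).trans (Finset.card_range _).le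

variable [Fintype A]

lemma sum_word (x : ℕ → A) (k n : ℕ) (f : List A → ℝ) :
    ∑ i ∈ Finset.range (n + 1 - k), f (word x i k)
      = (n + 1 - k : ℕ) * ∑ w : Fin k → A, slidingFreq x k n w * f (List.ofFn w) := by
  rcases Nat.eq_zero_or_pos (n + 1 - k) with h | h
  · simp [h]
  have h0 : ((n + 1 - k : ℕ) : ℝ) ≠ 0 := by exact_mod_cast h.ne'
  rw [← Finset.sum_fiberwise (Finset.range (n + 1 - k)) (fun i (j : Fin k) => x (i + j)),
    Finset.mul_sum]
  refine Finset.sum_congr rfl fun w _ => ?_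
  have : ∀ i ∈ (Finset.range (n + 1 - k)).filter (fun i => (fun j : Fin k => x (i + j)) = w),
      f (word x i k) = f (List.ofFn w) := by
    intro i hi
    rw [word, (Finset.mem_filter.1 hi).2]
  rw [Finset.sum_congr rfl this, Finset.sum_const, nsmul_eq_mul, slidingFreq]
  simp only [funext_iff]
  field_simp

lemma sum_slidingFreq (x : ℕ → A) {k n : ℕ} (h : k ≤ n) :
    ∑ w : Fin k → A, slidingFreq x k n w = 1 := by
  have := sum_word x k n (fun _ => 1)
  have h0 : ((n + 1 - k : ℕ) : ℝ) ≠ 0 := by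
    have : n + 1 - k ≠ 0 := by omega
    exact_mod_cast this
  simp only [mul_one, Finset.sum_const, Finset.card_range, nsmul_eq_mul] at this
  exact mul_left_cancel₀ h0 (by rw [← this, mul_one])

lemma slidingEntropy_nonneg (x : ℕ → A) (k n : ℕ) : 0 ≤ slidingEntropy x k n :=
  div_nonneg (Finset.sum_nonneg fun w _ =>
    Real.negMulLog_nonneg (slidingFreq_nonneg x k n w) (slidingFreq_le_one x k n w))
    (Real.log_nonneg (by norm_num))

end Sliding

/-! ### Submultiplicative weights and empirical entropy -/

/-- Gibbs' inequality, for a positive weight that need not be normalized. -/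
lemma sum_negMulLog_add_le {ι : Type*} [Fintype ι] (q Q : ι → ℝ) (hq : ∀ i, 0 ≤ q i)
    (hq1 : ∑ i, q i = 1) (hQ : ∀ i, 0 < Q i) (T : ℝ) (hT : ∑ i, Q i ≤ T) :
    ∑ i, Real.negMulLog (q i) + ∑ i, q i * Real.log (Q i) ≤ Real.log T := by
  have hne : Nonempty ι := by
    by_contra h
    rw [not_nonempty_iff] at h
    simp at hq1
  have hT0 : 0 < T := (Finset.sum_pos (fun i _ => hQ i) Finset.univ_nonempty).trans_le hT
  have key : ∀ i, Real.negMulLog (q i) + q i * Real.log (Q i) - q i * Real.log T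
      ≤ Q i / T - q i := by
    intro i
    rcases (hq i).eq_or_lt with h | h
    · rw [← h]; simp; exact (div_pos (hQ i) hT0).le
    · have := Real.log_le_sub_one_of_pos (div_pos (div_pos (hQ i) hT0) h)
      rw [Real.log_div (div_pos (hQ i) hT0).ne' h.ne', Real.log_div (hQ i).ne' hT0.ne'] at this
      have h2 := mul_le_mul_of_nonneg_left this h.le
      have h3 : q i * (Q i / T / q i - 1) = Q i / T - q i := by field_simp
      rw [h3] at h2
      unfold Real.negMulLog
      linarith
  have := Finset.sum_le_sum fun i (_ : i ∈ Finset.univ) => key i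
  rw [Finset.sum_sub_distrib, Finset.sum_sub_distrib, Finset.sum_add_distrib, ← Finset.sum_mul,
    hq1, ← Finset.sum_div] at this
  have h4 := div_le_one_of_le₀ hT hT0.le
  linarith

/-- Submultiplicativity bounds the growth of `log g` along `z` by the values of `log g` on the
windows, and Gibbs' inequality turns the average of those values into an entropy bound. Cutting into
blocks at all `k` phases at once makes the average run over sliding windows. -/
lemma slidingEntropy_le_of_submultiplicative (z : ℕ → Bool) (g : List Bool → ℝ)
    (hpos : ∀ w, 0 < g w) (hmul : ∀ u v, g (u ++ v) ≤ g u * g v) (C : ℝ)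
    (hsum : ∀ k : ℕ, ∑ w : Fin k → Bool, g (List.ofFn w) ≤ C * 2 ^ k) (c K : ℝ) (hc : 0 ≤ c)
    (hlow : ∀ᶠ n : ℕ in atTop, c * n * Real.log 2 - K ≤ Real.log (g (word z 0 n)))
    (k : ℕ) (hk : 0 < k) :
    ∃ B : ℝ, ∀ᶠ n : ℕ in atTop, slidingEntropy z k n / k
      ≤ 1 - c + Real.log C / Real.log 2 / k + B / (n + 1 - k : ℕ) := by
  have hl2 : 0 < Real.log 2 := Real.log_pos (by norm_num)
  have hk' : (0 : ℝ) < k := by exact_mod_cast hk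
  have hC : 0 < C := by
    have h0 := hsum 0
    have h1 := hpos []
    simp at h0
    linarith
  set a : ℕ → ℝ := fun n => Real.log (g (word z 0 n)) with ha
  -- Passing from `U n` to `U (n + 1)` replaces `a n` by `a (n + k)`, at a cost of at most `log g`
  -- of the window at `n`; so `U` telescopes over all windows.
  set U : ℕ → ℝ := fun n => ∑ j ∈ Finset.range k, a (n + j) with hU
  have hstep : ∀ n, U (n + 1) ≤ U n + Real.log (g (word z n k)) := by
    intro n
    have e1 : U (n + 1) + a n = U n + a (n + k) := by
      have h1 := Finset.sum_range_succ (fun j => a (n + j)) k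
      have h2 := Finset.sum_range_succ' (fun j => a (n + j)) k
      simp only [hU]
      rw [← h1, h2]
      simp only [add_zero]
      congr 1
      exact Finset.sum_congr rfl fun j _ => by congr 1; omega
    have e2 : a (n + k) ≤ a n + Real.log (g (word z n k)) := by
      simp only [ha]
      rw [← Real.log_mul (hpos _).ne' (hpos _).ne', word_add, zero_add]
      exact Real.log_le_log (hpos _) (hmul _ _)
    linarith
  have htel : ∀ n, U n ≤ U 0 + ∑ i ∈ Finset.range n, Real.log (g (word z i k)) := by
    intro n
    induction n with
    | zero => simp
    | succ n ih =>
      rw [Finset.sum_range_succ]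
      linarith [hstep n]
  refine ⟨(U 0 + k * K) / (k * Real.log 2), ?_⟩
  obtain ⟨N, hN⟩ := eventually_atTop.1 hlow
  filter_upwards [eventually_ge_atTop (N + k)] with n hn
  set m := n + 1 - k with hm
  have hmN : N ≤ m := by omega
  have hm0 : (0 : ℝ) < m := by
    have : 0 < m := by omega
    exact_mod_cast this
  have h1 : k * (c * m * Real.log 2 - K) ≤ U m := by
    have : ∀ j ∈ Finset.range k, c * m * Real.log 2 - K ≤ a (m + j) := by
      intro j _
      refine le_trans ?_ (hN (m + j) (by omega))
      push_cast
      have : 0 ≤ c * j * Real.log 2 := by positivity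
      nlinarith
    have := Finset.card_nsmul_le_sum _ _ _ this
    simpa using this
  have h2 := htel m
  have h3 := sum_word z k n (fun w => Real.log (g w))
  have h4 := sum_negMulLog_add_le (slidingFreq z k n) (fun w => g (List.ofFn w))
    (slidingFreq_nonneg z k n) (sum_slidingFreq z (by omega)) (fun w => hpos _) _ (hsum k)
  rw [Real.log_mul hC.ne' (by positivity), Real.log_pow] at h4
  rw [← hm] at h3
  set E := ∑ w : Fin k → Bool, Real.negMulLog (slidingFreq z k n w) with hE
  set X := ∑ w : Fin k → Bool, slidingFreq z k n w * Real.log (g (List.ofFn w)) with hX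
  have h5 : (m : ℝ) * X ≤ m * (Real.log C + k * Real.log 2 - E) :=
    mul_le_mul_of_nonneg_left (by linarith) hm0.le
  have h6 : (m : ℝ) * E ≤ m * (Real.log C + k * Real.log 2) - k * (c * m * Real.log 2)
      + (U 0 + k * K) := by
    nlinarith
  have h7 : slidingEntropy z k n = E / Real.log 2 := rfl
  rw [h7, div_div, div_le_iff₀ (by positivity)]
  have h8 : (1 - c + Real.log C / Real.log 2 / k + (U 0 + k * K) / (k * Real.log 2) / m)
      * (Real.log 2 * k)
      = (m * (Real.log C + k * Real.log 2) - k * (c * m * Real.log 2) + (U 0 + k * K)) / m := by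
    field_simp
    ring
  rw [h8, le_div_iff₀ hm0]
  linarith

/-- A submultiplicative weight on words of total mass `O(2 ^ k)` on `{0, 1} ^ k` that grows at
least like `2 ^ (c n)` along `z` bounds the compressibility of `z` by `1 - c`. -/
lemma worstCompressibility_le (z : ℕ → Bool) (g : List Bool → ℝ)
    (hpos : ∀ w, 0 < g w) (hmul : ∀ u v, g (u ++ v) ≤ g u * g v) (C : ℝ)
    (hsum : ∀ k : ℕ, ∑ w : Fin k → Bool, g (List.ofFn w) ≤ C * 2 ^ k) (c K : ℝ) (hc : 0 ≤ c)
    (hlow : ∀ᶠ n : ℕ in atTop, c * n * Real.log 2 - K ≤ Real.log (g (word z 0 n))) :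
    worstCompressibility z ≤ 1 - c := by
  have main := slidingEntropy_le_of_submultiplicative z g hpos hmul C hsum c K hc hlow
  have hnn : ∀ k n : ℕ, 0 ≤ slidingEntropy z k n / k := fun k n =>
    div_nonneg (slidingEntropy_nonneg z k n) (by positivity)
  have inner : ∀ k : ℕ, 0 < k → ∀ η > 0, ∀ᶠ n : ℕ in atTop, slidingEntropy z k n / k
      ≤ 1 - c + Real.log C / Real.log 2 / k + η := by
    intro k hk η hη
    obtain ⟨B, hB⟩ := main k hk
    have ht : Tendsto (fun n : ℕ => B / ((n + 1 - k : ℕ) : ℝ)) atTop (nhds 0) := by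
      refine Tendsto.div_atTop tendsto_const_nhds (tendsto_natCast_atTop_atTop.comp ?_)
      refine tendsto_atTop_mono (f := fun n => n - k) (fun n => by omega)
        (tendsto_sub_atTop_nat k)
    filter_upwards [hB, ht.eventually_le_const hη] with n h1 h2
    linarith
  have hlim : ∀ k : ℕ, 0 < k → limsup (fun n : ℕ => slidingEntropy z k n / (k : ℝ)) atTop
      ≤ 1 - c + Real.log C / Real.log 2 / k := by
    intro k hk
    refine le_of_forall_pos_le_add fun η hη => limsup_le_of_le ?_ (inner k hk η hη)
    exact (isBoundedUnder_of ⟨0, fun n => hnn k n⟩ :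
      IsBoundedUnder (· ≥ ·) atTop _).isCoboundedUnder_le
  have hlim0 : ∀ k : ℕ, 0 < k → 0 ≤ limsup (fun n : ℕ => slidingEntropy z k n / (k : ℝ)) atTop := by
    intro k hk
    exact le_limsup_of_frequently_le (Frequently.of_forall fun n => hnn k n)
      ⟨_, eventually_map.2 (inner k hk 1 one_pos)⟩
  refine le_of_forall_pos_le_add fun η hη => limsup_le_of_le ?_ ?_
  · refine IsBoundedUnder.isCoboundedUnder_le ⟨0, eventually_map.2 ?_⟩
    filter_upwards [eventually_gt_atTop 0] with k hk using hlim0 k hk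
  · have ht : Tendsto (fun k : ℕ => Real.log C / Real.log 2 / (k : ℝ)) atTop (nhds 0) :=
      Tendsto.div_atTop tendsto_const_nhds tendsto_natCast_atTop_atTop
    filter_upwards [eventually_gt_atTop 0, ht.eventually_le_const hη] with k hk h2
    linarith [hlim k hk]

lemma worstPorosity_nonneg (z : ℕ → Bool) : 0 ≤ worstPorosity z := by
  -- The constant weight 1 has mass `2 ^ k` and growth rate `c = 0`.
  have := worstCompressibility_le z (fun _ => 1) (fun _ => one_pos) (fun _ _ => by norm_num) 1
    (fun k => by simp) 0 0 le_rfl (by simp)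
  simp only [worstPorosity, Fintype.card_bool, Nat.cast_ofNat, Real.logb_self_eq_one one_lt_two]
  linarith

/-! ### Independent identically distributed sequences -/

/-- The sequence that agrees with `x` before `q` and with `y` from `q` on. -/
def splice {A : Type*} (q : ℕ) (x y : ℕ → A) : ℕ → A := fun j => if j < q then x j else y j

section IID

variable {A : Type*} [MeasurableSpace A] (ν : Measure A) [IsProbabilityMeasure ν]

lemma measurable_splice (q : ℕ) :
    Measurable (fun p : (ℕ → A) × (ℕ → A) => splice q p.1 p.2) := by
  refine measurable_pi_lambda _ fun j => ?_
  unfold splice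
  split_ifs <;> fun_prop

/-- Independence of past and future in integrated form: the letters from `q` on may be replaced by
those of an independent copy. -/
lemma measurePreserving_splice (q : ℕ) :
    MeasurePreserving (fun p : (ℕ → A) × (ℕ → A) => splice q p.1 p.2)
      ((Measure.infinitePi fun _ : ℕ => ν).prod (Measure.infinitePi fun _ : ℕ => ν))
      (Measure.infinitePi fun _ : ℕ => ν) := by
  refine ⟨measurable_splice q, Measure.eq_infinitePi _ fun s t ht => ?_⟩
  rw [Measure.map_apply (measurable_splice q) (.pi s.countable_toSet fun i _ => ht i)]
  have : (fun p : (ℕ → A) × (ℕ → A) => splice q p.1 p.2) ⁻¹' (Set.pi s t)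
      = (Set.pi (s.filter (· < q) : Finset ℕ) t) ×ˢ (Set.pi (s.filter (¬ · < q) : Finset ℕ) t) := by
    ext ⟨x, y⟩
    simp only [Set.mem_preimage, Set.mem_pi, Set.mem_prod, splice, Finset.coe_filter,
      Set.mem_ofPred_eq, SetLike.mem_coe]
    constructor
    · intro h
      exact ⟨fun i hi => by simpa [hi.2] using h i hi.1, fun i hi => by simpa [hi.2] using h i hi.1⟩
    · intro h i hi
      by_cases hq : i < q
      · simpa [hq] using h.1 i ⟨hi, hq⟩
      · simpa [hq] using h.2 i ⟨hi, hq⟩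
  rw [this, Measure.prod_prod, Measure.infinitePi_pi _ (fun i _ => ht i),
    Measure.infinitePi_pi _ (fun i _ => ht i), Finset.prod_filter_mul_prod_filter_not]

lemma measurePreserving_shift (q : ℕ) :
    MeasurePreserving (fun x : ℕ → A => fun j => x (q + j))
      (Measure.infinitePi fun _ : ℕ => ν) (Measure.infinitePi fun _ : ℕ => ν) := by
  have hm : Measurable (fun x : ℕ → A => fun j => x (q + j)) := by fun_prop
  refine ⟨hm, Measure.eq_infinitePi _ fun s t ht => ?_⟩
  rw [Measure.map_apply hm (.pi s.countable_toSet fun i _ => ht i)]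
  have : (fun x : ℕ → A => fun j => x (q + j)) ⁻¹' (Set.pi s t)
      = Set.pi (s.map (addLeftEmbedding q) : Finset ℕ) fun i => t (i - q) := by
    ext x
    simp [Set.mem_pi]
  rw [this, Measure.infinitePi_pi _ (fun i _ => ht _), Finset.prod_map]
  simp

end IID

/-- A function that depends only on the first `N` letters of both sequences is measurable. -/
lemma measurable_of_local {A B X : Type*} [MeasurableSpace A] [MeasurableSpace B]
    [Finite A] [Finite B] [Nonempty A] [Nonempty B]
    [MeasurableSingletonClass A] [MeasurableSingletonClass B] [MeasurableSpace X]
    (f : (ℕ → A) × (ℕ → B) → X) (N : ℕ)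
    (hf : ∀ ω ω' : (ℕ → A) × (ℕ → B), (∀ j < N, ω.1 j = ω'.1 j) → (∀ j < N, ω.2 j = ω'.2 j) →
      f ω = f ω') : Measurable f := by
  classical
  let a : A := Classical.arbitrary A
  let b : B := Classical.arbitrary B
  let r : (ℕ → A) × (ℕ → B) → (Fin N → A) × (Fin N → B) :=
    fun ω => (fun j => ω.1 j, fun j => ω.2 j)
  let e : (Fin N → A) × (Fin N → B) → (ℕ → A) × (ℕ → B) :=
    fun v => (fun j => if h : j < N then v.1 ⟨j, h⟩ else a,
      fun j => if h : j < N then v.2 ⟨j, h⟩ else b)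
  have hr : Measurable r := by fun_prop
  have : f = (f ∘ e) ∘ r := by
    funext ω
    refine hf _ _ (fun j hj => ?_) (fun j hj => ?_) <;> simp [e, r, hj]
  rw [this]
  exact (measurable_of_finite _).comp hr

/-! ### Resampling the future of source and common randomness -/

section Joint

variable {A B : Type*} [MeasurableSpace A] [MeasurableSpace B]
  (μ : Measure A) [IsProbabilityMeasure μ] (ν : Measure B) [IsProbabilityMeasure ν]

/-- The law of two independent iid sequences. -/
noncomputable abbrev iidPair : Measure ((ℕ → A) × (ℕ → B)) :=
  (Measure.infinitePi fun _ : ℕ => μ).prod (Measure.infinitePi fun _ : ℕ => ν)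

lemma lintegral_splice (q n : ℕ) {f : (ℕ → A) × (ℕ → B) → ℝ≥0∞} (hf : Measurable f) :
    ∫⁻ ω, f ω ∂(iidPair μ ν)
      = ∫⁻ ω', ∫⁻ ω, f (splice q ω'.1 ω.1, splice n ω'.2 ω.2) ∂(iidPair μ ν) ∂(iidPair μ ν) := by
  have h1 := (measurePreserving_splice μ q).prod (measurePreserving_splice ν n)
  rw [← h1.lintegral_comp hf]
  have hs1 := measurable_splice (A := A) q
  have hs2 := measurable_splice (A := B) n
  have hF : Measurable fun p : ((ℕ → A) × (ℕ → A)) × ((ℕ → B) × (ℕ → B)) =>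
      f (splice q p.1.1 p.1.2, splice n p.2.1 p.2.2) :=
    hf.comp ((hs1.comp measurable_fst).prodMk (hs2.comp measurable_snd))
  have hF2 : Measurable fun p : ((ℕ → A) × (ℕ → A)) × (ℕ → B) =>
      ∫⁻ y, f (splice q p.1.1 p.1.2, splice n p.2 y) ∂(Measure.infinitePi fun _ : ℕ => ν) :=
    Measurable.lintegral_prod_right' (f := fun p : (((ℕ → A) × (ℕ → A)) × (ℕ → B)) × (ℕ → B) =>
      f (splice q p.1.1.1 p.1.1.2, splice n p.1.2 p.2))
      (hF.comp (by fun_prop : Measurable fun p : (((ℕ → A) × (ℕ → A)) × (ℕ → B)) × (ℕ → B) =>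
        (p.1.1, (p.1.2, p.2))))
  have hG : Measurable fun p : ((ℕ → A) × (ℕ → B)) × ((ℕ → A) × (ℕ → B)) =>
      f (splice q p.1.1 p.2.1, splice n p.1.2 p.2.2) :=
    hF.comp (by fun_prop : Measurable fun p : ((ℕ → A) × (ℕ → B)) × ((ℕ → A) × (ℕ → B)) =>
      ((p.1.1, p.2.1), (p.1.2, p.2.2)))
  calc _ = ∫⁻ p, ∫⁻ r, f (splice q p.1 p.2, splice n r.1 r.2)
        ∂((Measure.infinitePi fun _ : ℕ => ν).prod (Measure.infinitePi fun _ : ℕ => ν))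
        ∂((Measure.infinitePi fun _ : ℕ => μ).prod (Measure.infinitePi fun _ : ℕ => μ)) :=
        lintegral_prod _ hF.aemeasurable
    _ = ∫⁻ x', ∫⁻ x, ∫⁻ r, f (splice q x' x, splice n r.1 r.2)
        ∂((Measure.infinitePi fun _ : ℕ => ν).prod (Measure.infinitePi fun _ : ℕ => ν))
        ∂(Measure.infinitePi fun _ : ℕ => μ) ∂(Measure.infinitePi fun _ : ℕ => μ) :=
        lintegral_prod _ (hF.lintegral_prod_right').aemeasurable
    _ = ∫⁻ x', ∫⁻ y', ∫⁻ x, ∫⁻ y, f (splice q x' x, splice n y' y)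
        ∂(Measure.infinitePi fun _ : ℕ => ν) ∂(Measure.infinitePi fun _ : ℕ => μ)
        ∂(Measure.infinitePi fun _ : ℕ => ν) ∂(Measure.infinitePi fun _ : ℕ => μ) := by
        refine lintegral_congr fun x' => ?_
        refine Eq.trans (lintegral_congr fun x => lintegral_prod
          (fun r : (ℕ → B) × (ℕ → B) => f (splice q x' x, splice n r.1 r.2)) ?_)
          (lintegral_lintegral_swap (f := fun x y' => ∫⁻ y, f (splice q x' x, splice n y' y)
            ∂(Measure.infinitePi fun _ : ℕ => ν)) ?_)
        · exact (hF.comp (by fun_prop : Measurable fun r : (ℕ → B) × (ℕ → B) =>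
            ((x', x), r))).aemeasurable
        · exact (hF2.comp (by fun_prop : Measurable fun r : (ℕ → A) × (ℕ → B) =>
            ((x', r.1), r.2))).aemeasurable
    _ = ∫⁻ x', ∫⁻ y', ∫⁻ ω, f (splice q x' ω.1, splice n y' ω.2) ∂(iidPair μ ν)
        ∂(Measure.infinitePi fun _ : ℕ => ν) ∂(Measure.infinitePi fun _ : ℕ => μ) := by
        refine lintegral_congr fun x' => lintegral_congr fun y' => ?_
        refine (lintegral_prod (fun ω : (ℕ → A) × (ℕ → B) =>
          f (splice q x' ω.1, splice n y' ω.2)) ?_).symm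
        exact (hG.comp (by fun_prop : Measurable fun r : (ℕ → A) × (ℕ → B) =>
            ((x', y'), r))).aemeasurable
    _ = _ := (lintegral_prod _ (hG.lintegral_prod_right').aemeasurable).symm

lemma lintegral_shift (q n : ℕ) {f : (ℕ → A) × (ℕ → B) → ℝ≥0∞} (hf : Measurable f) :
    ∫⁻ ω, f (fun j => ω.1 (q + j), fun j => ω.2 (n + j)) ∂(iidPair μ ν)
      = ∫⁻ ω, f ω ∂(iidPair μ ν) :=
  ((measurePreserving_shift μ q).prod (measurePreserving_shift ν n)).lintegral_comp hf

end Joint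

/-- The law of a fair bit. -/
noncomputable abbrev coin : Measure Bool := (PMF.uniformOfFintype Bool).toMeasure

lemma coin_singleton (b : Bool) : coin {b} = 2⁻¹ := by
  rw [PMF.toMeasure_apply_singleton _ _ (measurableSet_singleton b)]
  simp

lemma lintegral_coin (f : Bool → ℝ≥0∞) : ∫⁻ x, f x ∂coin = 2⁻¹ * (f true + f false) := by
  rw [lintegral_fintype]
  simp only [coin_singleton, Fintype.sum_bool]
  ring

/-- Prescribing `r` fair bits is conditioning on an event of probability `2 ^ (-r)`, which raises
the mean of a nonnegative function by a factor of at most `2 ^ r`. -/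
lemma lintegral_splice_le {B : Type*} [MeasurableSpace B] (ν : Measure B) [IsProbabilityMeasure ν]
    (r : ℕ) (m : ℕ → Bool) {f : (ℕ → Bool) × (ℕ → B) → ℝ≥0∞} (hf : Measurable f) :
    ∫⁻ ω, f (splice r m ω.1, ω.2) ∂(iidPair coin ν) ≤ 2 ^ r * ∫⁻ ω, f ω ∂(iidPair coin ν) := by
  set C : Set ((ℕ → Bool) × (ℕ → B)) :=
    (Set.pi (Finset.range r : Finset ℕ) fun i => {m i}) ×ˢ Set.univ with hC
  have hCm : MeasurableSet C :=
    (MeasurableSet.pi (Finset.countable_toSet _) fun i _ => measurableSet_singleton _).prod .univ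
  have hCμ : iidPair coin ν C = (2 ^ r)⁻¹ := by
    rw [hC, Measure.prod_prod, Measure.infinitePi_pi _ (fun i _ => measurableSet_singleton _)]
    simp only [coin_singleton, Finset.prod_const, Finset.card_range, measure_univ, mul_one,
      ENNReal.inv_pow]
  have h2 : (2 : ℝ≥0∞) ^ r ≠ 0 := by simp
  have h2' : (2 : ℝ≥0∞) ^ r ≠ ∞ := by simp
  set I := ∫⁻ ω, f (splice r m ω.1, ω.2) ∂(iidPair coin ν) with hI
  have key : I * (2 ^ r)⁻¹ ≤ ∫⁻ ω, f ω ∂(iidPair coin ν) := by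
    -- Only the source is resampled; splicing the second sequence at `0` replaces it entirely by the
    -- fresh copy.
    rw [lintegral_splice coin ν r 0 hf, ← hCμ, ← lintegral_indicator_const hCm]
    refine lintegral_mono fun ω' => ?_
    by_cases hω' : ω' ∈ C
    swap
    · simp [Set.indicator_of_notMem hω']
    rw [Set.indicator_of_mem hω']
    refine le_of_eq (lintegral_congr fun ω => ?_)
    have e1 : splice r ω'.1 ω.1 = splice r m ω.1 := by
      funext j
      unfold splice
      split_ifs with hj
      · have := hω'.1 j (by simpa using hj)
        exact this
      · rfl
    have e2 : splice 0 ω'.2 ω.2 = ω.2 := by funext j; simp [splice]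
    rw [e1, e2]
  calc I = 2 ^ r * (I * (2 ^ r)⁻¹) := by
        rw [mul_comm I, ← mul_assoc, ENNReal.mul_inv_cancel h2 h2', one_mul]
    _ ≤ _ := by gcongr

/-! ### Weighing the estimates of a scheme

An estimated bit has weight `a` if it is wrong, and `b` if it is right. -/

/-- The weight of the estimate `m` of the bits of `M` from position `p` on. -/
noncomputable def bitsWeight (a b : ℝ≥0∞) {L : ℕ} (m : Fin L → Bool) (M : ℕ → Bool) (p : ℕ) :
    ℝ≥0∞ :=
  ∏ j : Fin L, if m j ≠ M (p + j) then a else b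

lemma measurable_bitsWeight (a b : ℝ≥0∞) {L : ℕ} (m : Fin L → Bool) (p : ℕ) :
    Measurable fun M : ℕ → Bool => bitsWeight a b m M p := by
  refine Finset.measurable_prod _ fun j _ => ?_
  exact (measurable_of_finite fun c : Bool => if m j ≠ c then a else b).comp
    (measurable_pi_apply (p + (j : ℕ)))

lemma lintegral_mul_of_split {A : Type*} [MeasurableSpace A] (μ : Measure A)
    [IsProbabilityMeasure μ] (q : ℕ) {f g : (ℕ → A) → ℝ≥0∞} (hf : Measurable f) (hg : Measurable g)
    (hfq : ∀ x y, f (splice q x y) = f x) (hgq : ∀ x y, g (splice q x y) = g y) :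
    ∫⁻ x, f x * g x ∂(Measure.infinitePi fun _ : ℕ => μ)
      = (∫⁻ x, f x ∂(Measure.infinitePi fun _ : ℕ => μ))
        * ∫⁻ x, g x ∂(Measure.infinitePi fun _ : ℕ => μ) := by
  refine ((measurePreserving_splice μ q).lintegral_comp (hf.mul hg)).symm.trans ?_
  rw [← lintegral_prod_mul hf.aemeasurable hg.aemeasurable]
  simp only [Pi.mul_apply, hfq, hgq]

/-- The bits at distinct positions are independent and fair, so each factor has mean `(a + b) / 2 =
1`, whatever the estimate. -/
lemma lintegral_bitsWeight {a b : ℝ≥0∞} (hab : a + b = 2) {L : ℕ} (m : Fin L → Bool) (p : ℕ) :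
    ∫⁻ M, bitsWeight a b m M p ∂(Measure.infinitePi fun _ : ℕ => coin) = 1 := by
  induction L with
  | zero => simp [bitsWeight]
  | succ L ih =>
    have h1 : Measurable fun c : Bool => if m (Fin.last L) ≠ c then a else b :=
      measurable_of_finite _
    have e : ∀ M, bitsWeight a b m M p = bitsWeight a b (fun j => m j.castSucc) M p
        * if m (Fin.last L) ≠ M (p + L) then a else b := fun M => by
      simp [bitsWeight, Fin.prod_univ_castSucc]
    have h2 : Measurable fun M : ℕ → Bool => if m (Fin.last L) ≠ M (p + L) then a else b :=
      h1.comp (measurable_pi_apply (p + L))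
    have h3 : ∫⁻ M, (if m (Fin.last L) ≠ M (p + L) then a else b)
        ∂(Measure.infinitePi fun _ : ℕ => coin) = 1 := by
      refine ((measurePreserving_eval_infinitePi (fun _ : ℕ => coin) (p + L)).lintegral_comp
        h1).trans ?_
      rw [lintegral_coin]
      cases m (Fin.last L) <;>
        simp [hab, add_comm b a, ENNReal.inv_mul_cancel two_ne_zero ENNReal.ofNat_ne_top]
    rw [lintegral_congr e, lintegral_mul_of_split coin (p + L) (measurable_bitsWeight a b _ p) h2,
      ih, h3, one_mul]
    · intro x y
      refine Finset.prod_congr rfl fun j _ => ?_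
      simp [splice]
    · intro x y
      simp [splice]

/-! ### Runs of a scheme along a noise word -/

namespace FSScheme

variable {S Θ : Type*} (F : FSScheme S Θ)

/-- The configuration reached from `c` after the noise word `w`. -/
def run (M : ℕ → Bool) : Config S → List Bool → (ℕ → Θ) → Config S
  | c, [], _ => c
  | c, z :: w, θ => run M (F.step M c z (θ 0)) w fun j => θ (1 + j)

/-- The weight of the estimates made in one channel use. -/
noncomputable def stepWeight (a b : ℝ≥0∞) (M : ℕ → Bool) (c : Config S) (z : Bool) (t : Θ) :
    ℝ≥0∞ :=
  bitsWeight a b (F.decMsg c.decState (F.outputAt M c z t) t) M c.ptr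

/-- The weight of the estimates made from the configuration `c` during the noise word `w`. -/
noncomputable def weight (a b : ℝ≥0∞) (M : ℕ → Bool) : Config S → List Bool → (ℕ → Θ) → ℝ≥0∞
  | _, [], _ => 1
  | c, z :: w, θ =>
    F.stepWeight a b M c z (θ 0) * weight a b M (F.step M c z (θ 0)) w fun j => θ (1 + j)

variable (a b : ℝ≥0∞)

lemma run_append (M : ℕ → Bool) (c : Config S) (u v : List Bool) (θ : ℕ → Θ) :
    F.run M c (u ++ v) θ = F.run M (F.run M c u θ) v fun j => θ (u.length + j) := by
  induction u generalizing c θ with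
  | nil => simp [run]
  | cons z u ih => simp [run, ih, add_assoc, add_comm]

lemma weight_append (M : ℕ → Bool) (c : Config S) (u v : List Bool) (θ : ℕ → Θ) :
    F.weight a b M c (u ++ v) θ
      = F.weight a b M c u θ * F.weight a b M (F.run M c u θ) v fun j => θ (u.length + j) := by
  induction u generalizing c θ with
  | nil => simp [run, weight]
  | cons z u ih => simp [run, weight, ih, add_assoc, add_comm, mul_assoc]

lemma ptr_le_run (M : ℕ → Bool) (c : Config S) (w : List Bool) (θ : ℕ → Θ) :
    c.ptr ≤ (F.run M c w θ).ptr := by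
  induction w generalizing c θ with
  | nil => exact le_rfl
  | cons z w ih =>
    have h : c.ptr ≤ (F.step M c z (θ 0)).ptr := Nat.le_add_right _ _
    exact h.trans (ih _ _)

lemma run_ptr_le {D : ℕ} (hD : ∀ s y t, F.decLen s y t ≤ D) (M : ℕ → Bool) (c : Config S)
    (w : List Bool) (θ : ℕ → Θ) : (F.run M c w θ).ptr ≤ c.ptr + w.length * D := by
  induction w generalizing c θ with
  | nil => simp [run]
  | cons z w ih =>
    refine (ih _ _).trans ?_
    have := hD c.decState (F.outputAt M c z (θ 0)) (θ 0)
    simp only [step, List.length_cons]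
    nlinarith

lemma exists_decLen_le [Finite S] [Finite Θ] : ∃ D, ∀ s y t, F.decLen s y t ≤ D := by
  obtain ⟨D, hD⟩ := (Set.finite_range fun x : S × Bool × Θ => F.decLen x.1 x.2.1 x.2.2).bddAbove
  exact ⟨D, fun s y t => hD ⟨(s, y, t), rfl⟩⟩

/-- A run depends only on the source bits that the encoder has seen. -/
lemma run_congr {M M' : ℕ → Bool} {c : Config S} {w : List Bool} {θ θ' : ℕ → Θ}
    (hM : ∀ j < (F.run M c w θ).ptr + (F.lookahead + 1), M j = M' j)
    (hθ : ∀ j < w.length, θ j = θ' j) :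
    F.run M' c w θ' = F.run M c w θ ∧ F.weight a b M' c w θ' = F.weight a b M c w θ := by
  induction w generalizing c θ θ' with
  | nil => exact ⟨rfl, rfl⟩
  | cons z w ih =>
    have h0 : θ' 0 = θ 0 := (hθ 0 (by simp)).symm
    have hle : (F.step M c z (θ 0)).ptr ≤ (F.run M c (z :: w) θ).ptr := F.ptr_le_run _ _ _ _
    have hc : c.ptr ≤ (F.step M c z (θ 0)).ptr := Nat.le_add_right _ _
    have hw : F.window M' c.ptr = F.window M c.ptr := by
      funext j
      exact (hM _ (by have := j.2; omega)).symm
    have ho : F.outputAt M' c z (θ 0) = F.outputAt M c z (θ 0) := by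
      rw [outputAt, outputAt, hw]
    have hs : F.step M' c z (θ 0) = F.step M c z (θ 0) := by
      simp only [step, ho, hw]
    have hsw : F.stepWeight a b M' c z (θ 0) = F.stepWeight a b M c z (θ 0) := by
      unfold stepWeight
      rw [ho]
      refine Finset.prod_congr rfl fun j _ => ?_
      have hj := j.2
      have hp : (F.step M c z (θ 0)).ptr
        = c.ptr + F.decLen c.decState (F.outputAt M c z (θ 0)) (θ 0) := rfl
      rw [hM (c.ptr + j) (by omega)]
    have := ih (c := F.step M c z (θ 0)) (θ := fun j => θ (1 + j)) (θ' := fun j => θ' (1 + j)) hM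
      (fun j hj => hθ _ (by simp; omega))
    simp only [run, weight, h0, hs, hsw]
    exact ⟨this.1, by rw [this.2]⟩

lemma window_shift (M : ℕ → Bool) (q p : ℕ) :
    F.window (fun j => M (q + j)) p = F.window M (q + p) := by
  funext j
  simp [window, add_assoc]

lemma step_shift (M : ℕ → Bool) (e d : S) (f : Bool) (q p : ℕ) (z : Bool) (t : Θ) :
    F.step M ⟨e, d, f, q + p⟩ z t =
      ⟨(F.step (fun j => M (q + j)) ⟨e, d, f, p⟩ z t).encState,
        (F.step (fun j => M (q + j)) ⟨e, d, f, p⟩ z t).decState,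
        (F.step (fun j => M (q + j)) ⟨e, d, f, p⟩ z t).fb,
        q + (F.step (fun j => M (q + j)) ⟨e, d, f, p⟩ z t).ptr⟩ := by
  simp [step, outputAt, window_shift, add_assoc]

/-- The scheme uses the pointer only to read the source relative to it, so a start at any pointer
reduces to a start at `0`. -/
lemma weight_shift (M : ℕ → Bool) (e d : S) (f : Bool) (q p : ℕ) (w : List Bool) (θ : ℕ → Θ) :
    F.weight a b M ⟨e, d, f, q + p⟩ w θ
      = F.weight a b (fun j => M (q + j)) ⟨e, d, f, p⟩ w θ := by
  induction w generalizing e d f p θ with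
  | nil => rfl
  | cons z w ih =>
    rw [weight, weight, step_shift, ih]
    congr 1
    have ho : F.outputAt M ⟨e, d, f, q + p⟩ z (θ 0)
        = F.outputAt (fun j => M (q + j)) ⟨e, d, f, p⟩ z (θ 0) := by
      simp only [outputAt, window_shift]
    unfold stepWeight
    rw [ho]
    simp only [bitsWeight, add_assoc]

lemma countable_config [Finite S] : Countable (Config S) := by
  have : Function.Injective fun c : Config S => (c.encState, c.decState, c.fb, c.ptr) := by
    rintro ⟨_, _, _, _⟩ ⟨_, _, _, _⟩ h
    simpa using h
  exact this.countable

/-- The mean weight of the estimates made from `c` during the noise word `w`. -/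
noncomputable def meanWeight [MeasurableSpace Θ] (c : Config S) (w : List Bool) : ℝ≥0∞ :=
  ∫⁻ ω, F.weight a b ω.1 c w ω.2 ∂F.law

/-- A bound on the conditional mean weight given all that happened earlier. -/
noncomputable def potential [MeasurableSpace Θ] (w : List Bool) : ℝ≥0∞ :=
  2 ^ (F.lookahead + 1) * ∑' s : S × S × Bool, F.meanWeight a b ⟨s.1, s.2.1, s.2.2, 0⟩ w

lemma meanWeight_le_potential [MeasurableSpace Θ] (e d : S) (f : Bool) (w : List Bool) :
    F.meanWeight a b ⟨e, d, f, 0⟩ w ≤ F.potential a b w := by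
  refine (ENNReal.le_tsum (f := fun s : S × S × Bool =>
    F.meanWeight a b ⟨s.1, s.2.1, s.2.2, 0⟩ w) (e, d, f)).trans ?_
  exact le_mul_of_one_le_left' (one_le_pow₀ (by norm_num))

/-! ### Submultiplicativity of the mean weight -/

section Measure

variable [Finite S] [Finite Θ] [MeasurableSpace Θ] [MeasurableSingletonClass Θ]

lemma measurable_run_weight {X : Type*} [MeasurableSpace X] (c : Config S) (w : List Bool)
    (φ : Config S → ℝ≥0∞ → X) :
    Measurable fun ω : (ℕ → Bool) × (ℕ → Θ) =>
      φ (F.run ω.1 c w ω.2) (F.weight a b ω.1 c w ω.2) := by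
  obtain ⟨D, hD⟩ := F.exists_decLen_le
  have : Nonempty Θ := F.pθ.support_nonempty.nonempty
  refine measurable_of_local _ (c.ptr + w.length * D + (F.lookahead + 1) + w.length)
    fun ω ω' h1 h2 => ?_
  have hr := F.run_ptr_le hD ω.1 c w ω.2
  obtain ⟨e1, e2⟩ := F.run_congr a b (M := ω.1) (M' := ω'.1) (c := c) (w := w) (θ := ω.2)
    (θ' := ω'.2) (fun j hj => h1 j (by omega)) (fun j hj => h2 j (by omega))
  rw [e1, e2]

lemma measurable_weight (c : Config S) (w : List Bool) :
    Measurable fun ω : (ℕ → Bool) × (ℕ → Θ) => F.weight a b ω.1 c w ω.2 :=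
  F.measurable_run_weight a b c w fun _ x => x

/-- From the pointer on, the source consists of `ℓ + 1` prescribed bits followed by fresh ones.
Shifting moves the pointer to `0`, the prescribed bits cost `2 ^ (ℓ + 1)`, and the remaining mean is
one term of the sum in `potential`. -/
lemma lintegral_weight_splice_le (c : Config S) (n : ℕ) (w : List Bool) (m : ℕ → Bool)
    (θ' : ℕ → Θ) :
    ∫⁻ ω, F.weight a b (splice (c.ptr + (F.lookahead + 1)) m ω.1) c w
        (fun j => splice n θ' ω.2 (n + j)) ∂F.law ≤ F.potential a b w := by
  obtain ⟨e, d, f, p⟩ := c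
  set m' : ℕ → Bool := fun j => m (p + j)
  have e1 : ∀ M : ℕ → Bool, F.weight a b (splice (p + (F.lookahead + 1)) m M) ⟨e, d, f, p⟩ w
      = F.weight a b (splice (F.lookahead + 1) m' fun j => M (p + j)) ⟨e, d, f, 0⟩ w := by
    intro M
    funext θ
    have h := F.weight_shift a b (splice (p + (F.lookahead + 1)) m M) e d f p 0 w θ
    rw [add_zero] at h
    rw [h]
    congr 1
    funext j
    simp [splice, m']
  have hm : Measurable fun ω : (ℕ → Bool) × (ℕ → Θ) =>
      F.weight a b (splice (F.lookahead + 1) m' ω.1) ⟨e, d, f, 0⟩ w ω.2 := by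
    have h := (measurable_splice (A := Bool) (F.lookahead + 1)).comp
      (measurable_prodMk_left (x := m'))
    exact (F.measurable_weight a b ⟨e, d, f, 0⟩ w).comp
      ((h.comp measurable_fst).prodMk measurable_snd)
  simp only [e1]
  have e2 : ∀ x : ℕ → Θ, (fun j => splice n θ' x (n + j)) = fun j => x (n + j) := by
    intro x; funext j; simp [splice]
  simp only [e2]
  have h1 := lintegral_shift coin F.pθ.toMeasure p n hm
  have h2 := lintegral_splice_le F.pθ.toMeasure (F.lookahead + 1) m'
    (F.measurable_weight a b ⟨e, d, f, 0⟩ w)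
  refine (h1.trans_le h2).trans ?_
  unfold potential
  gcongr
  exact ENNReal.le_tsum (f := fun s : S × S × Bool =>
    F.meanWeight a b ⟨s.1, s.2.1, s.2.2, 0⟩ w) (e, d, f)

/-- The argument splits according to the configuration `c₁` reached after `u`. This makes the
pointer deterministic, so everything beyond what the run along `u` has seen can be resampled; the
mean of the future factor is then at most `potential`, uniformly in the past. -/
lemma meanWeight_append_le (c : Config S) (u v : List Bool) :
    F.meanWeight a b c (u ++ v) ≤ F.meanWeight a b c u * F.potential a b v := by
  classical
  have := countable_config (S := S)
  have hind : ∀ c₁ : Config S, Measurable fun ω : (ℕ → Bool) × (ℕ → Θ) =>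
      if F.run ω.1 c u ω.2 = c₁ then F.weight a b ω.1 c u ω.2 else 0 := fun c₁ =>
    F.measurable_run_weight a b c u fun c' x => if c' = c₁ then x else 0
  have hshift : ∀ c₁ : Config S, Measurable fun ω : (ℕ → Bool) × (ℕ → Θ) =>
      F.weight a b ω.1 c₁ v fun j => ω.2 (u.length + j) := fun c₁ =>
    (F.measurable_weight a b c₁ v).comp (by fun_prop :
      Measurable fun ω : (ℕ → Bool) × (ℕ → Θ) => (ω.1, fun j => ω.2 (u.length + j)))
  have hsum : ∀ x : Config S → ℝ≥0∞, ∀ c' : Config S,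
      ∑' c₁, (if c' = c₁ then x c₁ else 0) = x c' := by
    intro x c'
    rw [tsum_eq_single c' (fun c₁ h => by simp [h.symm])]
    simp
  have hpoint : ∀ c₁ : Config S,
      ∫⁻ ω, (if F.run ω.1 c u ω.2 = c₁ then F.weight a b ω.1 c u ω.2 else 0)
        * F.weight a b ω.1 c₁ v (fun j => ω.2 (u.length + j)) ∂F.law
      ≤ (∫⁻ ω, (if F.run ω.1 c u ω.2 = c₁ then F.weight a b ω.1 c u ω.2 else 0) ∂F.law)
        * F.potential a b v := by
    intro c₁
    refine (lintegral_splice coin F.pθ.toMeasure (c₁.ptr + (F.lookahead + 1)) u.length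
      ((hind c₁).mul (hshift c₁))).trans_le ?_
    rw [← lintegral_mul_const _ (hind c₁)]
    refine lintegral_mono fun ω' => ?_
    by_cases h : F.run ω'.1 c u ω'.2 = c₁
    · rw [if_pos h]
      have hloc : ∀ ω : (ℕ → Bool) × (ℕ → Θ), _ := fun ω =>
        F.run_congr a b (M := ω'.1) (M' := splice (c₁.ptr + (F.lookahead + 1)) ω'.1 ω.1) (c := c)
          (w := u) (θ := ω'.2) (θ' := splice u.length ω'.2 ω.2)
          (fun j hj => by rw [h] at hj; simp [splice, hj]) (fun j hj => by simp [splice, hj])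
      simp only [Pi.mul_apply, hloc, h, if_true]
      rw [lintegral_const_mul _ ?_]
      · gcongr
        exact F.lintegral_weight_splice_le a b c₁ u.length v ω'.1 ω'.2
      · exact (hshift c₁).comp
          ((((measurable_splice _).comp (measurable_prodMk_left (x := ω'.1))).comp
            measurable_fst).prodMk
          (((measurable_splice _).comp (measurable_prodMk_left (x := ω'.2))).comp measurable_snd))
    · rw [if_neg h, zero_mul, nonpos_iff_eq_zero]
      -- If the spliced run reached `c₁`, it would have read only letters that agree with `ω'`, so
      -- the run of `ω'` would reach `c₁` too.
      refine (lintegral_congr fun ω => ?_).trans lintegral_zero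
      rw [Pi.mul_apply, if_neg, zero_mul]
      intro h'
      have := F.run_congr a b (M' := ω'.1) (M := splice (c₁.ptr + (F.lookahead + 1)) ω'.1 ω.1)
          (c := c) (w := u) (θ' := ω'.2) (θ := splice u.length ω'.2 ω.2)
          (fun j hj => by rw [h'] at hj; simp [splice, hj]) (fun j hj => by simp [splice, hj])
      exact h (this.1.trans h')
  calc F.meanWeight a b c (u ++ v)
      = ∫⁻ ω, ∑' c₁, (if F.run ω.1 c u ω.2 = c₁ then F.weight a b ω.1 c u ω.2 else 0)
        * F.weight a b ω.1 c₁ v (fun j => ω.2 (u.length + j)) ∂F.law := by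
        refine lintegral_congr fun ω => ?_
        simp only [ite_mul, zero_mul]
        rw [hsum fun c₁ => F.weight a b ω.1 c u ω.2
          * F.weight a b ω.1 c₁ v fun j => ω.2 (u.length + j), weight_append]
    _ = ∑' c₁, ∫⁻ ω, (if F.run ω.1 c u ω.2 = c₁ then F.weight a b ω.1 c u ω.2 else 0)
        * F.weight a b ω.1 c₁ v (fun j => ω.2 (u.length + j)) ∂F.law :=
        lintegral_tsum fun c₁ => ((hind c₁).mul (hshift c₁)).aemeasurable
    _ ≤ ∑' c₁, (∫⁻ ω, (if F.run ω.1 c u ω.2 = c₁ then F.weight a b ω.1 c u ω.2 else 0) ∂F.law)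
        * F.potential a b v := ENNReal.tsum_le_tsum hpoint
    _ = F.meanWeight a b c u * F.potential a b v := by
        rw [ENNReal.tsum_mul_right, ← lintegral_tsum fun c₁ => (hind c₁).aemeasurable]
        congr 1
        exact lintegral_congr fun ω => hsum (fun _ => F.weight a b ω.1 c u ω.2) _

lemma potential_append_le (u v : List Bool) :
    F.potential a b (u ++ v) ≤ F.potential a b u * F.potential a b v := by
  calc F.potential a b (u ++ v) ≤ 2 ^ (F.lookahead + 1) * ∑' s : S × S × Bool,
        F.meanWeight a b ⟨s.1, s.2.1, s.2.2, 0⟩ u * F.potential a b v := by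
        unfold potential
        gcongr
        exact F.meanWeight_append_le a b _ u v
    _ = _ := by rw [ENNReal.tsum_mul_right, ← mul_assoc]; rfl

end Measure

end FSScheme

/-! ### Total mass of the weights over all noise words -/

lemma sum_ofFn_succ {M : Type*} [AddCommMonoid M] (k : ℕ) (φ : List Bool → M) :
    ∑ w : Fin (k + 1) → Bool, φ (List.ofFn w)
      = ∑ z : Bool, ∑ w : Fin k → Bool, φ (z :: List.ofFn w) := by
  rw [← Fintype.sum_prod_type', ← (Fin.consEquiv fun _ : Fin (k + 1) => Bool).sum_comp]
  exact Finset.sum_congr rfl fun x _ => by simp [Fin.consEquiv]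

lemma bitsWeight_exp (A B : ℝ) {L : ℕ} (m : Fin L → Bool) (M : ℕ → Bool) (p : ℕ) :
    bitsWeight (.ofReal (Real.exp A)) (.ofReal (Real.exp B)) m M p
      = .ofReal (Real.exp (((Finset.univ.filter fun j : Fin L => m j ≠ M (p + j)).card : ℝ) * A
        + (L - ((Finset.univ.filter fun j : Fin L => m j ≠ M (p + j)).card : ℝ)) * B)) := by
  have h1 : ∀ j : Fin L, (if m j ≠ M (p + j) then ENNReal.ofReal (Real.exp A)
      else ENNReal.ofReal (Real.exp B))
      = ENNReal.ofReal (Real.exp (if m j ≠ M (p + j) then A else B)) := fun j => by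
    split_ifs <;> rfl
  have h2 := Finset.card_filter_add_card_filter_not (s := Finset.univ)
    (fun j : Fin L => m j ≠ M (p + j))
  rw [Finset.card_univ, Fintype.card_fin] at h2
  have h3 : (L : ℝ) = ((Finset.univ.filter fun j : Fin L => m j ≠ M (p + j)).card : ℝ)
      + ((Finset.univ.filter fun j : Fin L => ¬ m j ≠ M (p + j)).card : ℝ) := by
    exact_mod_cast h2.symm
  unfold bitsWeight
  rw [Finset.prod_congr rfl fun j _ => h1 j,
    ← ENNReal.ofReal_prod_of_nonneg fun j _ => (Real.exp_pos _).le, ← Real.exp_sum,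
    Finset.sum_ite, Finset.sum_const, Finset.sum_const, nsmul_eq_mul, nsmul_eq_mul, h3,
    add_sub_cancel_left]

lemma bitsWeight_ne_zero {a b : ℝ≥0∞} (ha : a ≠ 0) (hb : b ≠ 0) {L : ℕ} (m : Fin L → Bool)
    (M : ℕ → Bool) (p : ℕ) : bitsWeight a b m M p ≠ 0 := by
  refine Finset.prod_ne_zero_iff.2 fun j _ => ?_
  split_ifs <;> assumption

namespace FSScheme

variable {S Θ : Type*} (F : FSScheme S Θ) (a b : ℝ≥0∞)

lemma weight_ne_zero (ha : a ≠ 0) (hb : b ≠ 0) (M : ℕ → Bool) (c : Config S) (w : List Bool)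
    (θ : ℕ → Θ) : F.weight a b M c w θ ≠ 0 := by
  induction w generalizing c θ with
  | nil => simp [weight]
  | cons z w ih => exact mul_ne_zero (bitsWeight_ne_zero ha hb _ _ _) (ih _ _)

/-- The weight of the estimates made while the decoder receives a given output word. -/
noncomputable def decWeight (M : ℕ → Bool) : S → ℕ → List Bool → (ℕ → Θ) → ℝ≥0∞
  | _, _, [], _ => 1
  | d, p, y :: w, θ => bitsWeight a b (F.decMsg d y (θ 0)) M p
      * decWeight M (F.decUpdate d y (θ 0)) (p + F.decLen d y (θ 0)) w fun j => θ (1 + j)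

lemma decWeight_splice (M M' : ℕ → Bool) (d : S) (q p : ℕ) (hq : q ≤ p) (w : List Bool)
    (θ : ℕ → Θ) : F.decWeight a b (splice q M' M) d p w θ = F.decWeight a b M d p w θ := by
  induction w generalizing d p θ with
  | nil => rfl
  | cons y w ih =>
    rw [decWeight, decWeight, ih _ _ (by omega)]
    congr 1
    refine Finset.prod_congr rfl fun j _ => ?_
    simp [splice, show ¬ p + (j : ℕ) < q by omega]

lemma measurable_decWeight (d : S) (p : ℕ) (w : List Bool) (θ : ℕ → Θ) :
    Measurable fun M => F.decWeight a b M d p w θ := by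
  induction w generalizing d p θ with
  | nil => exact measurable_const
  | cons y w ih => exact (measurable_bitsWeight a b _ p).mul (ih _ _ _)

variable {a b} in
-- Once the outputs and the common randomness are fixed, the estimates do not depend on the source,
-- and successive ones concern disjoint blocks of it; the means multiply.
lemma lintegral_decWeight (hab : a + b = 2) (d : S) (p : ℕ) (w : List Bool) (θ : ℕ → Θ) :
    ∫⁻ M, F.decWeight a b M d p w θ ∂(Measure.infinitePi fun _ : ℕ => coin) = 1 := by
  induction w generalizing d p θ with
  | nil => simp [decWeight]
  | cons y w ih =>
    simp only [decWeight]
    rw [lintegral_mul_of_split coin (p + F.decLen d y (θ 0)) (measurable_bitsWeight a b _ p)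
      (F.measurable_decWeight a b _ _ _ _), ih, lintegral_bitsWeight hab, one_mul]
    · intro x x'
      refine Finset.prod_congr rfl fun j _ => ?_
      simp [splice]
    · intro x x'
      exact F.decWeight_splice a b _ _ _ _ _ le_rfl _ _

/-- For a fixed source, the noise word and the output word determine each other. -/
lemma sum_weight (M : ℕ → Bool) (c : Config S) (k : ℕ) (θ : ℕ → Θ) :
    ∑ w : Fin k → Bool, F.weight a b M c (List.ofFn w) θ
      = ∑ w : Fin k → Bool, F.decWeight a b M c.decState c.ptr (List.ofFn w) θ := by
  induction k generalizing c θ with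
  | zero => simp [weight, decWeight]
  | succ k ih =>
    rw [sum_ofFn_succ k fun w => F.weight a b M c w θ,
      sum_ofFn_succ k fun w => F.decWeight a b M c.decState c.ptr w θ]
    simp only [weight, decWeight, ← Finset.mul_sum, ih]
    simp only [step, stepWeight, outputAt, Fintype.sum_bool]
    -- Adding the input bit to the noise bit either fixes or swaps the two terms of the sum.
    cases F.enc c.encState (F.window M c.ptr) c.fb (θ 0)
    · rfl
    · exact add_comm _ _

section Measure

variable [MeasurableSpace Θ]

variable {a b} in
lemma sum_meanWeight [Finite S] [Finite Θ] [MeasurableSingletonClass Θ] (hab : a + b = 2)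
    (c : Config S) (k : ℕ) :
    ∑ w : Fin k → Bool, F.meanWeight a b c (List.ofFn w) = 2 ^ k := by
  unfold meanWeight
  rw [← lintegral_finsetSum _ fun w _ => F.measurable_weight a b c _]
  refine (lintegral_prod_symm' _
    (Finset.measurable_fun_sum _ fun w _ => F.measurable_weight a b c (List.ofFn w))).trans ?_
  simp only [sum_weight]
  simp_rw [lintegral_finsetSum _ fun w _ => F.measurable_decWeight a b _ _ _ _]
  simp [F.lintegral_decWeight hab]

variable {a b} in
lemma sum_potential [Fintype S] [Finite Θ] [MeasurableSingletonClass Θ] (hab : a + b = 2)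
    (k : ℕ) :
    ∑ w : Fin k → Bool, F.potential a b (List.ofFn w)
      = 2 ^ (F.lookahead + 1) * Fintype.card (S × S × Bool) * 2 ^ k := by
  unfold potential
  rw [← Finset.mul_sum]
  simp only [tsum_fintype]
  rw [Finset.sum_comm]
  simp only [F.sum_meanWeight hab, Finset.sum_const, nsmul_eq_mul, Finset.card_univ, mul_assoc]

variable {a b} in
lemma potential_ne_top [Finite S] [Finite Θ] [MeasurableSingletonClass Θ] (hab : a + b = 2)
    (w : List Bool) : F.potential a b w ≠ ∞ := by
  have := Fintype.ofFinite S
  have h := F.sum_potential hab w.length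
  have h1 : F.potential a b w ≤ ∑ v : Fin w.length → Bool, F.potential a b (List.ofFn v) := by
    refine (le_of_eq ?_).trans (Finset.single_le_sum (f := fun v : Fin w.length → Bool =>
      F.potential a b (List.ofFn v)) (fun _ _ => zero_le) (Finset.mem_univ w.get))
    rw [List.ofFn_get]
  refine ne_top_of_le_ne_top ?_ h1
  rw [h]
  finiteness

variable {a b} in
lemma potential_ne_zero [Finite S] [Finite Θ] [MeasurableSingletonClass Θ] (ha : a ≠ 0)
    (hb : b ≠ 0) (w : List Bool) : F.potential a b w ≠ 0 := by
  have h := F.meanWeight_le_potential a b F.encInit F.decInit F.fbInit w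
  intro h0
  rw [h0, nonpos_iff_eq_zero, meanWeight, lintegral_eq_zero_iff (F.measurable_weight a b _ _)] at h
  have hl : IsProbabilityMeasure F.law := by unfold law; infer_instance
  obtain ⟨ω, hω⟩ := h.exists
  exact F.weight_ne_zero a b ha hb _ _ _ _ hω

end Measure

/-! ### Growth of the weight along the actual noise -/

/-- The configuration before the first channel use. -/
def init : Config S := ⟨F.encInit, F.decInit, F.fbInit, 0⟩

lemma run_word (M z : ℕ → Bool) (θ : ℕ → Θ) (n : ℕ) :
    F.run M F.init (word z 0 n) θ = F.config M z θ n := by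
  induction n with
  | zero => rfl
  | succ n ih =>
    rw [word_add, run_append, ih, word_one]
    simp [run, config, length_word]

lemma errors_le_len (M z : ℕ → Bool) (θ : ℕ → Θ) (i : ℕ) : F.errors M z θ i ≤ F.len M z θ i :=
  (Finset.card_filter_le _ _).trans (by simp [len])

lemma weight_word (A B : ℝ) (M z : ℕ → Bool) (θ : ℕ → Θ) (n : ℕ) :
    F.weight (.ofReal (Real.exp A)) (.ofReal (Real.exp B)) M F.init (word z 0 n) θ
      = .ofReal (Real.exp ((∑ i ∈ Finset.range n, (F.errors M z θ i : ℝ)) * A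
        + (∑ i ∈ Finset.range n, (F.len M z θ i : ℝ)
          - ∑ i ∈ Finset.range n, (F.errors M z θ i : ℝ)) * B)) := by
  induction n with
  | zero => simp [word, weight]
  | succ n ih =>
    rw [word_add, weight_append, ih, run_word, word_one, length_word, weight, weight, stepWeight,
      bitsWeight_exp, mul_one, zero_add, ← ENNReal.ofReal_mul (Real.exp_pos _).le, ← Real.exp_add,
      Finset.sum_range_succ, Finset.sum_range_succ]
    congr 2
    simp only [add_zero]
    rw [show F.decLen (F.config M z θ n).decState (F.outputAt M (F.config M z θ n) (z n) (θ n))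
      (θ n) = F.len M z θ n from rfl]
    change _ + ((F.errors M z θ n : ℝ) * A + ((F.len M z θ n : ℝ) - (F.errors M z θ n : ℝ)) * B) = _
    ring

lemma rate_nonneg (M z : ℕ → Bool) (θ : ℕ → Θ) (n : ℕ) : 0 ≤ F.rate M z θ n := by
  unfold rate; positivity

lemma bitErrorRate_nonneg (M z : ℕ → Bool) (θ : ℕ → Θ) (n : ℕ) : 0 ≤ F.bitErrorRate M z θ n := by
  unfold bitErrorRate; positivity

lemma bitErrorRate_le_one (M z : ℕ → Bool) (θ : ℕ → Θ) (n : ℕ) : F.bitErrorRate M z θ n ≤ 1 := by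
  refine div_le_one_of_le₀ (Finset.sum_le_sum fun i _ => ?_) (by positivity)
  exact_mod_cast F.errors_le_len M z θ i

end FSScheme

lemma one_sub_hb_nonneg (β : ℝ) : 0 ≤ 1 - hb β := by
  have := (div_le_one (Real.log_pos one_lt_two)).2 (Real.binEntropy_le_log_two (p := β))
  unfold hb
  linarith

/-- The growth per estimated bit of the log-weight when a fraction `β` of the estimates is wrong. -/
lemma one_sub_hb_mul_log {β : ℝ} (h0 : 0 < β) (h1 : β < 1) :
    (1 - hb β) * Real.log 2 = β * Real.log (2 * β) + (1 - β) * Real.log (2 * (1 - β)) := by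
  have hl : Real.log 2 ≠ 0 := (Real.log_pos one_lt_two).ne'
  rw [Real.log_mul two_ne_zero h0.ne', Real.log_mul two_ne_zero (by linarith), sub_mul, hb,
    div_mul_cancel₀ _ hl, Real.binEntropy, Real.log_inv, Real.log_inv]
  ring

namespace FSScheme

variable {S Θ : Type*} (F : FSScheme S Θ)

/-- As `β ≤ 1 / 2`, a wrong bit weighs no more than a right one, so the worst case is an error
fraction of exactly `β`. -/
lemma le_weight_word {β R' : ℝ} (hβ0 : 0 < β) (hβ : β ≤ 1 / 2) (hR : 0 ≤ R') (M z : ℕ → Bool)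
    (θ : ℕ → Θ) (n : ℕ) (h1 : R' < F.rate M z θ n) (h2 : F.bitErrorRate M z θ n < β) :
    ENNReal.ofReal (Real.exp (R' * (1 - hb β) * n * Real.log 2))
      ≤ F.weight (.ofReal (Real.exp (Real.log (2 * β))))
        (.ofReal (Real.exp (Real.log (2 * (1 - β))))) M F.init (word z 0 n) θ := by
  rw [weight_word]
  refine ENNReal.ofReal_le_ofReal (Real.exp_le_exp.2 ?_)
  unfold rate at h1
  unfold bitErrorRate at h2
  set T := ∑ i ∈ Finset.range n, (F.len M z θ i : ℝ)
  set E := ∑ i ∈ Finset.range n, (F.errors M z θ i : ℝ)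
  have hn : (0 : ℝ) < n := by
    rcases n.eq_zero_or_pos with h | h
    -- At `n = 0` the rate is `0 / 0 = 0`, which does not exceed `R' ≥ 0`.
    · subst h; simp at h1; linarith
    · exact_mod_cast h
  have hT : R' * n < T := (lt_div_iff₀ hn).1 h1
  have hT0 : 0 < T := lt_of_le_of_lt (by positivity) hT
  have hE : E < β * T := (div_lt_iff₀ hT0).1 h2
  have hAB : Real.log (2 * β) ≤ Real.log (2 * (1 - β)) :=
    Real.log_le_log (by positivity) (by linarith)
  have hh := one_sub_hb_mul_log hβ0 (by linarith)
  have hc : 0 ≤ (1 - hb β) * Real.log 2 :=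
    mul_nonneg (one_sub_hb_nonneg β) (Real.log_nonneg one_le_two)
  calc R' * (1 - hb β) * n * Real.log 2 = R' * n * ((1 - hb β) * Real.log 2) := by ring
    _ ≤ T * ((1 - hb β) * Real.log 2) := by gcongr
    _ = T * Real.log (2 * (1 - β))
        - β * T * (Real.log (2 * (1 - β)) - Real.log (2 * β)) := by rw [hh]; ring
    _ ≤ T * Real.log (2 * (1 - β)) - E * (Real.log (2 * (1 - β)) - Real.log (2 * β)) := by
        have := mul_le_mul_of_nonneg_right hE.le (sub_nonneg.2 hAB)
        linarith
    _ = _ := by ring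

variable [MeasurableSpace Θ]

instance : IsProbabilityMeasure F.law := by unfold law; infer_instance

variable {F}

lemma WorstCaseAchieves.error_nonneg {z : ℕ → Bool} {p R ε : ℝ} (hp : 0 < p)
    (hF : F.WorstCaseAchieves z p R ε) : 0 ≤ ε := by
  obtain ⟨ω, -, hω⟩ := nonempty_of_measureReal_ne_zero (hp.trans_le hF).ne'
  refine le_trans ?_ hω
  exact le_limsup_of_frequently_le
    (Frequently.of_forall fun n => F.bitErrorRate_nonneg _ _ _ _)
    (isBoundedUnder_of ⟨1, fun n => F.bitErrorRate_le_one _ _ _ _⟩)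

/-- By continuity from below, a single threshold `N` serves on an event of probability more than `p
/ 2`; Markov's inequality turns the pointwise bound there into one on the mean. -/
lemma WorstCaseAchieves.exists_le_meanWeight [Finite S] [Finite Θ] [MeasurableSingletonClass Θ]
    {z : ℕ → Bool} {p R ε : ℝ} (hp : 0 < p)
    (hF : F.WorstCaseAchieves z p R ε) {β R' : ℝ} (hβ0 : 0 < β) (hβ : β ≤ 1 / 2) (hεβ : ε < β)
    (hR0 : 0 ≤ R') (hR : R' < R) :
    ∀ᶠ n : ℕ in atTop, ENNReal.ofReal (p / 2 * Real.exp (R' * (1 - hb β) * n * Real.log 2))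
      ≤ F.meanWeight (.ofReal (Real.exp (Real.log (2 * β))))
        (.ofReal (Real.exp (Real.log (2 * (1 - β))))) F.init (word z 0 n) := by
  set B : ℕ → Set ((ℕ → Bool) × (ℕ → Θ)) := fun N =>
    {ω | ∀ n ≥ N, R' < F.rate ω.1 z ω.2 n ∧ F.bitErrorRate ω.1 z ω.2 n < β} with hB
  have hmono : Monotone B := fun N N' h ω hω n hn => hω n (h.trans hn)
  have hsub : {ω | R ≤ liminf (fun n => F.rate ω.1 z ω.2 n) atTop ∧
      limsup (fun n => F.bitErrorRate ω.1 z ω.2 n) atTop ≤ ε} ⊆ ⋃ N, B N := by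
    rintro ω ⟨h1, h2⟩
    have e1 := eventually_lt_of_lt_liminf (hR.trans_le h1)
      (isBoundedUnder_of ⟨0, fun n => F.rate_nonneg _ _ _ _⟩)
    have e2 := eventually_lt_of_limsup_lt (h2.trans_lt hεβ)
      (isBoundedUnder_of ⟨1, fun n => F.bitErrorRate_le_one _ _ _ _⟩)
    obtain ⟨N, hN⟩ := eventually_atTop.1 (e1.and e2)
    exact Set.mem_iUnion.2 ⟨N, hN⟩
  have hlim := tendsto_measure_iUnion_atTop (μ := F.law) hmono
  have hlt : ENNReal.ofReal (p / 2) < F.law (⋃ N, B N) := by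
    refine ((ENNReal.ofReal_lt_ofReal_iff hp).2 (by linarith)).trans_le ?_
    refine le_trans ?_ (measure_mono hsub)
    exact (ENNReal.ofReal_le_iff_le_toReal (measure_ne_top _ _)).2 hF
  obtain ⟨N, hN⟩ := (hlim.eventually (lt_mem_nhds hlt)).exists
  filter_upwards [eventually_ge_atTop N] with n hn
  rw [mul_comm, ENNReal.ofReal_mul (Real.exp_pos _).le]
  refine le_trans ?_ (mul_meas_ge_le_lintegral (F.measurable_weight _ _ _ _)
    (ENNReal.ofReal (Real.exp (R' * (1 - hb β) * n * Real.log 2))))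
  gcongr
  refine hN.le.trans (measure_mono fun ω hω => ?_)
  exact F.le_weight_word hβ0 hβ hR0 _ _ _ _ (hω n hn).1 (hω n hn).2

lemma WorstCaseAchieves.mul_le_worstPorosity [Finite S] [Finite Θ] [MeasurableSingletonClass Θ]
    {z : ℕ → Bool} {p R ε : ℝ} (hp : 0 < p)
    (hF : F.WorstCaseAchieves z p R ε) {β R' : ℝ} (hβ0 : 0 < β) (hβ : β ≤ 1 / 2) (hεβ : ε < β)
    (hR0 : 0 ≤ R') (hR : R' < R) : R' * (1 - hb β) ≤ worstPorosity z := by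
  have := Fintype.ofFinite S
  set a := ENNReal.ofReal (Real.exp (Real.log (2 * β))) with ha
  set b := ENNReal.ofReal (Real.exp (Real.log (2 * (1 - β)))) with hb'
  have ha0 : a ≠ 0 := by simp [ha, Real.exp_pos]
  have hb0 : b ≠ 0 := by simp [hb', Real.exp_pos]
  have hab : a + b = 2 := by
    rw [ha, hb', Real.exp_log (by linarith), Real.exp_log (by linarith),
      ← ENNReal.ofReal_add (by linarith) (by linarith)]
    ring_nf
    simp
  have htop := F.potential_ne_top hab
  have hpos : ∀ w, 0 < (F.potential a b w).toReal := fun w =>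
    ENNReal.toReal_pos (F.potential_ne_zero ha0 hb0 w) (htop w)
  have key := worstCompressibility_le z (fun w => (F.potential a b w).toReal) hpos
    (fun u v => by
      rw [← ENNReal.toReal_mul]
      exact ENNReal.toReal_mono (ENNReal.mul_ne_top (htop u) (htop v))
        (F.potential_append_le a b u v))
    (2 ^ (F.lookahead + 1) * Fintype.card (S × S × Bool))
    (fun k => by
      rw [← ENNReal.toReal_sum fun w _ => htop _, F.sum_potential hab]
      simp)
    (R' * (1 - hb β)) (-Real.log (p / 2)) (mul_nonneg hR0 (one_sub_hb_nonneg β)) (by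
      filter_upwards [hF.exists_le_meanWeight hp hβ0 hβ hεβ hR0 hR] with n hn
      have h1 := hn.trans (F.meanWeight_le_potential a b _ _ _ _)
      have h2 := (ENNReal.ofReal_le_iff_le_toReal (htop _)).1 h1
      have h3 := Real.log_le_log (by positivity) h2
      rw [Real.log_mul (by positivity) (Real.exp_pos _).ne', Real.log_exp] at h3
      linarith)
  simp only [worstPorosity, Fintype.card_bool, Nat.cast_ofNat, Real.logb_self_eq_one one_lt_two]
  linarith

theorem WorstCaseAchieves.rate_mul_le [Finite S] [Finite Θ] [MeasurableSingletonClass Θ]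
    {z : ℕ → Bool} {p R ε : ℝ} (hp : 0 < p) (hε : ε ≤ 1 / 2)
    (hF : F.WorstCaseAchieves z p R ε) : R * (1 - hb ε) ≤ worstPorosity z := by
  have hε0 := hF.error_nonneg hp
  rcases le_or_gt R 0 with hR | hR
  · exact (mul_nonpos_of_nonpos_of_nonneg hR (one_sub_hb_nonneg ε)).trans (worstPorosity_nonneg z)
  -- At `ε = 1 / 2` there is no room for `β` in `(ε, 1 / 2)`, but the left side vanishes.
  rcases hε.eq_or_lt with rfl | hε
  · have : hb (1 / 2) = 1 := by
      rw [hb, one_div, Real.binEntropy_two_inv, div_self (Real.log_pos one_lt_two).ne']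
    rw [this, sub_self, mul_zero]
    exact worstPorosity_nonneg z
  have hcont : Continuous hb := Real.binEntropy_continuous.div_const _
  have h1 : ∀ β ∈ Set.Ioo ε (1 / 2), R * (1 - hb β) ≤ worstPorosity z := by
    intro β hβ
    have ht : Tendsto (fun R' : ℝ => R' * (1 - hb β)) (nhdsWithin R (Set.Iio R))
        (nhds (R * (1 - hb β))) :=
      ((continuous_id.mul continuous_const).tendsto R).mono_left nhdsWithin_le_nhds
    refine le_of_tendsto ht ?_
    filter_upwards [Ioo_mem_nhdsLT hR] with R' hR'
    exact hF.mul_le_worstPorosity hp (hε0.trans_lt hβ.1) hβ.2.le hβ.1 hR'.1.le hR'.2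
  have ht : Tendsto (fun β : ℝ => R * (1 - hb β)) (nhdsWithin ε (Set.Ioi ε))
      (nhds (R * (1 - hb ε))) :=
    ((continuous_const.mul (continuous_const.sub hcont)).tendsto ε).mono_left nhdsWithin_le_nhds
  refine le_of_tendsto ht ?_
  filter_upwards [Ioo_mem_nhdsGT hε] with β hβ using h1 β hβ

end FSScheme

end Porosity

theorem theorem2 {S Θ : Type*} [Finite S] [Finite Θ] [MeasurableSpace Θ]
    [MeasurableSingletonClass Θ] (F : Porosity.FSScheme S Θ) (z : ℕ → Bool) (p R ε : ℝ)
    (hp : 0 < p) (hε : ε ≤ 1 / 2) (hF : F.WorstCaseAchieves z p R ε) :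
    (R ≤ 1 → R ≤ Porosity.hb ε + Porosity.worstPorosity z) ∧
      R * (1 - Porosity.hb ε) ≤ Porosity.worstPorosity z := by
  have h := hF.rate_mul_le hp hε
  refine ⟨fun hR => ?_, h⟩
  have h0 : 0 ≤ Porosity.hb ε :=
    div_nonneg (Real.binEntropy_nonneg (hF.error_nonneg hp) (by linarith))
      (Real.log_nonneg one_le_two)
  -- `R = R * (1 - hb ε) + R * hb ε`, and the last term is at most `hb ε`.
  nlinarith
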